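/- Let $d\ge 1$ and let $(X_i,Y_i)_{i\ge 1}$ be independent and identically distributed random vectors in $\mathbb R^d\times\mathbb R$. Let $\|\cdot\|$ be the Euclidean norm and, for $x\in[0,1]^d$, let $F(\cdot\,|\,x)$ be the cumulative distribution function of $\kappa(x,\cdot)$, where $\kappa$ is a regular conditional distribution of $Y_1$ given $X_1=x$. Assume: (B) $X_1$ takes values in $[0,1]^d$ and has there a density $f_X$ with $b\le f_X\le U$, where $0<b\le U<\infty$; (L) $\sup_{y\in\mathbb R}|F(y|x)-F(y|x')|\le L\|x-x'\|$ for all $x,x'\in[0,1]^d$. Let $(k_n)_{n\ge1}$ be integers with $1\le k_n\le n$. For $x\in[0,1]^d$ let $\hat B_n(x)$ be the closed Euclidean ball with center $x$ and smallest radius that contains at least $k_n$ of the points $X_1,\dots,X_n$, and define the nearest neighbour estimate $$\hat F_n(y|x)=\frac{\sum_{i=1}^n \mathbf 1\{Y_i\le y\}\,\mathbf 1\{X_i\in\hat B_n(x)\}}{\sum_{i=1}^n \mathbf 1\{X_i\in\hat B_n(x)\}},\qquad y\in\mathbb R .$$ If $k_n/n\to0$ and $\log(n)/k_n\to0$ as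 $n\to\infty$, then almost surely $$\sup_{y\in\mathbb R,\;x\in[0,1]^d}\bigl|\hat F_n(y|x)-F(y|x)\bigr| = O\left(\sqrt{\frac{d}{k_n}\log n}+\Bigl(\frac{k_n}{n}\Bigr)^{1/d}\right)\qquad (n\to\infty).$$ More precisely, there is a constant $C$ depending only on $d,b,U,L$ such that, almost surely, the left-hand side is at most $C$ times the rate in parentheses for all sufficiently large $n$. -/

import Mathlib

open MeasureTheory ProbabilityTheory Filter Topology

noncomputable section

/-- The unit cube `[0,1]^d` in Euclidean space. -/
def unitCube (d : ℕ) : Set (EuclideanSpace ℝ (Fin d)) :=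
  {x | ∀ j, x j ∈ Set.Icc (0 : ℝ) 1}

/-- The measure `P` is carried by the unit cube and has there a density `f` with respect to
Lebesgue measure such that `b ≤ f ≤ U`. -/
def HasDensityBetween {d : ℕ} (P : Measure (EuclideanSpace ℝ (Fin d))) (b U : ℝ) : Prop :=
  ∃ f : EuclideanSpace ℝ (Fin d) → ℝ, Measurable f ∧
    (∀ x ∈ unitCube d, b ≤ f x ∧ f x ≤ U) ∧
    P = (volume.restrict (unitCube d)).withDensity (fun x => ENNReal.ofReal (f x))

/-- The nearest neighbour radius at `x`: the smallest `τ ≥ 0` such that the closed ball with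
center `x` and radius `τ` contains at least `k` of the `n` data points `X 0, …, X (n - 1)`.
The infimum is attained for `k ≤ n`. -/
def knnRadius {d : ℕ} (n k : ℕ) (X : ℕ → EuclideanSpace ℝ (Fin d))
    (x : EuclideanSpace ℝ (Fin d)) : ℝ :=
  sInf {τ : ℝ | 0 ≤ τ ∧
    (k : ℝ) ≤ ∑ i ∈ Finset.range n, (Metric.closedBall x τ).indicator (fun _ => (1 : ℝ)) (X i)}

/-- The nearest neighbour ball at `x`. -/
def knnBall {d : ℕ} (n k : ℕ) (X : ℕ → EuclideanSpace ℝ (Fin d))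
    (x : EuclideanSpace ℝ (Fin d)) : Set (EuclideanSpace ℝ (Fin d)) :=
  Metric.closedBall x (knnRadius n k X x)

/-- The nearest neighbour estimate at `(y, x)` of the conditional distribution function, computed
from the data `(X 0, Y 0), …, (X (n - 1), Y (n - 1))` with `k` neighbours. -/
def knnCondCdf {d : ℕ} (n k : ℕ) (X : ℕ → EuclideanSpace ℝ (Fin d)) (Y : ℕ → ℝ)
    (y : ℝ) (x : EuclideanSpace ℝ (Fin d)) : ℝ :=
  (∑ i ∈ Finset.range n, (Set.Iic y).indicator (fun _ => (1 : ℝ)) (Y i) *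
      (knnBall n k X x).indicator (fun _ => (1 : ℝ)) (X i)) /
    ∑ i ∈ Finset.range n, (knnBall n k X x).indicator (fun _ => (1 : ℝ)) (X i)

end

/-! The error at `(y, x)` is the average over the nearest neighbours of `1{Y i ≤ y} - F(y | X i)`
plus the average of `F(y | X i) - F(y | x)` (`abs_knnCondCdf_sub_cdf_le`).

The second average is at most `|L|` times the nearest neighbour radius. Cut the cube into `m ^ d`
cells with `m ^ d ≤ n b / (2 k)`. Each cell has at least `2 k` expected points, so by a Chernoff
bound and Borel–Cantelli all cells eventually contain `k` points
(`ae_eventually_le_count_gridCell`). The radius is then at most the cell diameter `√d / m`, of order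
`(k / n) ^ (1 / d)`.

For the first average, fix the `X i`. The set `S` of neighbours is cut out by a ball, and balls cut
out only polynomially many sets (`card_ballTraces_le`). For each `S` the `Y i` are independent with
unequal laws, and a Dvoretzky–Kiefer–Wolfowitz type bound controls all `y` at once
(`measure_exists_count_deviation_le`). A union bound gives a deviation of at most `a √|S| + 1` for
all `S` and `y`, with `a ^ 2` a multiple of `log n` (`ae_eventually_centeredCount_le`). Dividing by
`|S| ≥ k` gives `a / √k + 1 / k`. -/

/-! ### Vapnik–Chervonenkis bound for balls -/

section BallTraces

variable {E : Type*} [NormedAddCommGroup E] {ι : Type*} [Fintype ι]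

open scoped Classical in
/-- The sets of indices that closed balls cut out of the family of points `x`. -/
noncomputable def ballTraces (x : ι → E) : Finset (Finset ι) :=
  Finset.univ.filter fun S => ∃ (c : E) (r : ℝ), ∀ i, i ∈ S ↔ x i ∈ Metric.closedBall c r

lemma mem_ballTraces {x : ι → E} {S : Finset ι} :
    S ∈ ballTraces x ↔ ∃ (c : E) (r : ℝ), ∀ i, i ∈ S ↔ x i ∈ Metric.closedBall c r := by
  simp [ballTraces]

variable [InnerProductSpace ℝ E]

/-- The condition is affine in `(x, ‖x‖ ^ 2)`, so on the paraboloid in `E × ℝ` balls become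
half-spaces. -/
lemma mem_closedBall_iff_lift {x c : E} {r : ℝ} (hr : 0 ≤ r) :
    x ∈ Metric.closedBall c r ↔ ‖x‖ ^ 2 - 2 * inner ℝ c x ≤ r ^ 2 - ‖c‖ ^ 2 := by
  rw [mem_closedBall_iff_norm, ← sq_le_sq₀ (norm_nonneg _) hr, norm_sub_sq_real, real_inner_comm]
  constructor <;> intro h <;> linarith

variable [FiniteDimensional ℝ E]

-- More than `finrank + 2` points, lifted to the paraboloid in dimension `finrank + 1`, have a Radon
-- partition. A ball cutting out one part would put the common point of the two convex hulls on both
-- sides of a hyperplane.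
open scoped Classical in
lemma card_le_of_ballTraces_shatters {x : ι → E} {s : Finset ι}
    (hs : (ballTraces x).Shatters s) : s.card ≤ Module.finrank ℝ E + 2 := by
  by_contra! hcard
  let f : s → E × ℝ := fun i => (x i, ‖x i‖ ^ 2)
  have hdep : ¬ AffineIndependent ℝ f := by
    intro hf
    have := hf.card_le_finrank_succ
    have h2 : Module.finrank ℝ (vectorSpan ℝ (Set.range f)) ≤ Module.finrank ℝ (E × ℝ) :=
      Submodule.finrank_le _
    rw [Module.finrank_prod, Module.finrank_self] at h2
    rw [Fintype.card_coe] at this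
    omega
  obtain ⟨I, p, hp1, hp2⟩ := Convex.radon_partition hdep
  obtain ⟨u, hu, hsu⟩ := hs (t := s.filter fun i => ∃ h : i ∈ s, (⟨i, h⟩ : s) ∈ I)
    (Finset.filter_subset _ _)
  obtain ⟨c, r, hcr⟩ := mem_ballTraces.1 hu
  have key : ∀ i : s, i ∈ I ↔ x i ∈ Metric.closedBall c r := by
    intro i
    rw [← hcr]
    have h := congrArg (fun t => (i : ι) ∈ t) hsu
    simpa using h.symm
  rcases lt_or_ge r 0 with hr | hr
  · have hI : I = ∅ := by
      ext i
      simp [key, Metric.closedBall_eq_empty.2 hr]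
    simp [hI] at hp1
  let g : E × ℝ →ₗ[ℝ] ℝ :=
    LinearMap.snd ℝ E ℝ - (2 : ℝ) • ((innerSL ℝ c).toLinearMap ∘ₗ LinearMap.fst ℝ E ℝ)
  have hg : ∀ i, g (f i) = ‖x i‖ ^ 2 - 2 * inner ℝ c (x i) := by
    intro i; simp [g, f]
  have h1 : p ∈ {q | g q ≤ r ^ 2 - ‖c‖ ^ 2} := by
    refine convexHull_min ?_ (convex_halfSpace_le g.isLinear _) hp1
    rintro _ ⟨i, hi, rfl⟩
    rw [Set.mem_ofPred_eq, hg, ← mem_closedBall_iff_lift hr]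
    exact (key i).1 hi
  have h2 : p ∈ {q | r ^ 2 - ‖c‖ ^ 2 < g q} := by
    refine convexHull_min ?_ (convex_halfSpace_gt g.isLinear _) hp2
    rintro _ ⟨i, hi, rfl⟩
    rw [Set.mem_ofPred_eq, hg, ← not_le, ← mem_closedBall_iff_lift hr]
    exact fun h => hi ((key i).2 h)
  simp only [Set.mem_ofPred_eq] at h1 h2
  exact h1.not_gt h2

/-- Closed balls cut only polynomially many subsets out of a finite family of points. -/
lemma card_ballTraces_le [Nonempty ι] (x : ι → E) :
    (ballTraces x).card ≤
      (Module.finrank ℝ E + 3) * Fintype.card ι ^ (Module.finrank ℝ E + 2) := by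
  classical
  set D := Module.finrank ℝ E + 2 with hD
  have hvc : (ballTraces x).vcDim ≤ D :=
    Finset.sup_le fun s hs => card_le_of_ballTraces_shatters (Finset.mem_shatterer.1 hs)
  -- The Sauer–Shelah lemma; the sum has `D + 1` terms, each at most `|ι| ^ D`.
  calc (ballTraces x).card ≤ (ballTraces x).shatterer.card := Finset.card_le_card_shatterer _
    _ ≤ ∑ k ∈ Finset.Iic (ballTraces x).vcDim, (Fintype.card ι).choose k :=
        Finset.card_shatterer_le_sum_vcDim
    _ ≤ ∑ k ∈ Finset.Iic D, (Fintype.card ι).choose k :=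
        Finset.sum_le_sum_of_subset (Finset.Iic_subset_Iic.2 hvc)
    _ ≤ ∑ _k ∈ Finset.Iic D, Fintype.card ι ^ D := by
        refine Finset.sum_le_sum fun k hk => (Nat.choose_le_pow _ _).trans ?_
        exact Nat.pow_le_pow_right Fintype.card_pos (Finset.mem_Iic.1 hk)
    _ = (Module.finrank ℝ E + 3) * Fintype.card ι ^ D := by simp [hD]

end BallTraces

/-! ### Deviations uniform over half-lines -/

section UniformHoeffding

/-- A finite measure on the line has quantiles. -/
lemma exists_quantile (ν : Measure ℝ) [IsFiniteMeasure ν] {a : ℝ} (ha : 0 < a)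
    (ha' : a < ν.real Set.univ) :
    ∃ t, ν.real (Set.Iio t) ≤ a ∧ a ≤ ν.real (Set.Iic t) := by
  have hbot : Tendsto (fun y => ν.real (Set.Iic y)) atBot (𝓝 0) := by
    have h := tendsto_measure_iInter_atBot (μ := ν) (s := fun y : ℝ => Set.Iic y)
      (fun y => measurableSet_Iic.nullMeasurableSet) monotone_Iic ⟨0, measure_ne_top ν _⟩
    have h0 : ⋂ y : ℝ, Set.Iic y = ∅ := by
      ext z
      simp only [Set.mem_iInter, Set.mem_Iic, Set.mem_empty_iff_false, iff_false, not_forall]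
      exact ⟨z - 1, by linarith⟩
    rw [h0, measure_empty] at h
    exact (ENNReal.tendsto_toReal ENNReal.zero_ne_top).comp h
  have htop : Tendsto (fun y => ν.real (Set.Iic y)) atTop (𝓝 (ν.real Set.univ)) :=
    (ENNReal.tendsto_toReal (measure_ne_top ν _)).comp (tendsto_measure_Iic_atTop ν)
  -- The quantile is `sInf T`: continuity from below bounds the open half-line, continuity from
  -- above the closed one.
  set T : Set ℝ := {y | a ≤ ν.real (Set.Iic y)} with hT
  have hne : T.Nonempty := (htop.eventually (eventually_ge_nhds ha')).exists
  have hbdd : BddBelow T := by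
    obtain ⟨y₀, hy₀⟩ := (hbot.eventually (eventually_lt_nhds ha)).exists
    refine ⟨y₀, fun y hy => le_of_not_gt fun hlt => ?_⟩
    have h : a ≤ ν.real (Set.Iic y) := hy
    have : ν.real (Set.Iic y) ≤ ν.real (Set.Iic y₀) :=
      measureReal_mono (Set.Iic_subset_Iic.2 hlt.le)
    linarith
  refine ⟨sInf T, ?_, ?_⟩
  · obtain ⟨u, hu_mono, hu_lt, hu_tendsto⟩ := exists_seq_strictMono_tendsto (sInf T)
    have h := tendsto_measure_iUnion_atTop (μ := ν) (s := fun n => Set.Iic (u n))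
      (fun i j hij => Set.Iic_subset_Iic.2 (hu_mono.monotone hij))
    have hU : ⋃ n, Set.Iic (u n) = Set.Iio (sInf T) := by
      ext z
      simp only [Set.mem_iUnion, Set.mem_Iic, Set.mem_Iio]
      refine ⟨fun ⟨n, hn⟩ => hn.trans_lt (hu_lt n), fun hz => ?_⟩
      obtain ⟨n, hn⟩ := (hu_tendsto.eventually (eventually_gt_nhds hz)).exists
      exact ⟨n, hn.le⟩
    rw [hU] at h
    refine le_of_tendsto' ((ENNReal.tendsto_toReal (measure_ne_top ν _)).comp h) fun n => ?_
    by_contra! hlt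
    exact (csInf_le hbdd (show u n ∈ T from hlt.le)).not_gt (hu_lt n)
  · have h : Tendsto (fun y => ν.real (Set.Iic y)) (𝓝[>] (sInf T))
        (𝓝 (ν.real (⋂ r > sInf T, Set.Iic r))) :=
      (ENNReal.tendsto_toReal (measure_ne_top ν _)).comp
        (tendsto_measure_biInter_gt (fun r _ => measurableSet_Iic.nullMeasurableSet)
          (fun i j _ hij => Set.Iic_subset_Iic.2 hij) ⟨sInf T + 1, by simp, measure_ne_top ν _⟩)
    have hI : ⋂ r > sInf T, Set.Iic r = Set.Iic (sInf T) := by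
      ext z
      simp only [Set.mem_iInter, Set.mem_Iic]
      exact ⟨fun hz => le_of_forall_gt_imp_ge_of_dense hz, fun hz r hr => hz.trans hr.le⟩
    rw [hI] at h
    refine ge_of_tendsto h ?_
    filter_upwards [self_mem_nhdsWithin] with y hy
    obtain ⟨z, hz, hzy⟩ := exists_lt_of_csInf_lt hne hy
    exact le_trans (show a ≤ ν.real (Set.Iic z) from hz)
      (measureReal_mono (Set.Iic_subset_Iic.2 hzy.le))

variable {Ω : Type*} [MeasurableSpace Ω] {P : Measure Ω} [IsProbabilityMeasure P]
  {ι : Type*} {Z : ι → Ω → ℝ}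

/-- Hoeffding's inequality: a centered indicator is sub-Gaussian with parameter `1 / 4`. -/
lemma measure_count_sub_ge_le (hZ : ∀ i, Measurable (Z i)) (hind : iIndepFun Z P)
    (S : Finset ι) {A : Set ℝ} (hA : MeasurableSet A) {s : ℝ} (hs : 0 ≤ s) :
    P.real {ω | s ≤ ∑ i ∈ S, (A.indicator (fun _ => (1 : ℝ)) (Z i ω) - P.real (Z i ⁻¹' A))} ≤
      Real.exp (-2 * s ^ 2 / S.card) := by
  have hm : Measurable (A.indicator (fun _ => (1 : ℝ))) := measurable_const.indicator hA
  have hint : ∀ i, ∫ ω, A.indicator (fun _ => (1 : ℝ)) (Z i ω) ∂P = P.real (Z i ⁻¹' A) := by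
    intro i
    rw [← integral_indicator_one (hZ i hA)]
    rfl
  have hsub : ∀ i ∈ S, HasSubgaussianMGF
      (fun ω => A.indicator (fun _ => (1 : ℝ)) (Z i ω) - P.real (Z i ⁻¹' A))
      ((‖(1 : ℝ) - 0‖₊ / 2) ^ 2) P := by
    intro i _
    rw [← hint i]
    refine hasSubgaussianMGF_of_mem_Icc (hm.comp (hZ i)).aemeasurable (ae_of_all _ fun ω => ?_)
    by_cases h : Z i ω ∈ A <;> simp [h]
  have hind' : iIndepFun
      (fun i ω => A.indicator (fun _ => (1 : ℝ)) (Z i ω) - P.real (Z i ⁻¹' A)) P :=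
    hind.comp (fun i z => A.indicator (fun _ => (1 : ℝ)) z - P.real (Z i ⁻¹' A))
      fun i => hm.sub_const _
  refine (HasSubgaussianMGF.measure_sum_ge_le_of_iIndepFun hind' hsub hs).trans_eq ?_
  congr 1
  simp
  ring

/-- A Dvoretzky–Kiefer–Wolfowitz type inequality, with a linear factor, for independent but not
necessarily identically distributed random variables. -/
lemma measure_exists_count_deviation_le (hZ : ∀ i, Measurable (Z i)) (hind : iIndepFun Z P)
    (S : Finset ι) {s : ℝ} (hs : 0 ≤ s) :
    P.real {ω | ∃ y, s + 1 < |∑ i ∈ S,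
        ((Set.Iic y).indicator (fun _ => (1 : ℝ)) (Z i ω) - P.real (Z i ⁻¹' Set.Iic y))|} ≤
      2 * S.card * Real.exp (-2 * s ^ 2 / S.card) := by
  classical
  set m := S.card with hm
  -- The sum of the laws has mass `m`. Its quantiles `t j` at integer levels serve as thresholds;
  -- passing from `y` to a neighbouring threshold costs at most 1, the `+ 1` in the statement.
  set ν : Measure ℝ := ∑ i ∈ S, P.map (Z i) with hν
  have hνreal : ∀ A, MeasurableSet A → ν.real A = ∑ i ∈ S, P.real (Z i ⁻¹' A) := by
    intro A hA
    rw [hν, Measure.real, Measure.finsetSum_apply,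
      ENNReal.toReal_sum fun i _ => measure_ne_top _ _]
    refine Finset.sum_congr rfl fun i _ => ?_
    rw [Measure.map_apply (hZ i) hA, Measure.real]
  have hνuniv : ν.real Set.univ = m := by
    rw [hνreal _ MeasurableSet.univ]; simp [hm]
  have hex : ∀ j : ℕ, ∃ t, 0 < j → j < m →
      ν.real (Set.Iio t) ≤ j ∧ (j : ℝ) ≤ ν.real (Set.Iic t) := by
    intro j
    by_cases hj : 0 < j ∧ j < m
    · obtain ⟨t, ht⟩ := exists_quantile ν (a := j) (by exact_mod_cast hj.1)
        (by rw [hνuniv]; exact_mod_cast hj.2)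
      exact ⟨t, fun _ _ => ht⟩
    · exact ⟨0, fun h1 h2 => absurd ⟨h1, h2⟩ hj⟩
  choose t ht using hex
  let B : Set ℝ → Set Ω := fun A =>
    {ω | s ≤ ∑ i ∈ S, (A.indicator (fun _ => (1 : ℝ)) (Z i ω) - P.real (Z i ⁻¹' A))}
  have hB : ∀ A, MeasurableSet A → P.real (B A) ≤ Real.exp (-2 * s ^ 2 / m) :=
    fun A hA => measure_count_sub_ge_le hZ hind S hA hs
  have hsum : ∀ (A : Set ℝ) ω, MeasurableSet A →
      ∑ i ∈ S, (A.indicator (fun _ => (1 : ℝ)) (Z i ω) - P.real (Z i ⁻¹' A)) =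
      ∑ i ∈ S, A.indicator (fun _ => (1 : ℝ)) (Z i ω) - ν.real A := by
    intro A ω hA
    rw [Finset.sum_sub_distrib, hνreal A hA]
  have hsub : {ω | ∃ y, s + 1 < |∑ i ∈ S,
        ((Set.Iic y).indicator (fun _ => (1 : ℝ)) (Z i ω) - P.real (Z i ⁻¹' Set.Iic y))|} ⊆
      ⋃ j ∈ Finset.range m, (B (Set.Iio (t j)) ∪ B (Set.Ioi (t j))) := by
    rintro ω ⟨y, hy⟩
    by_contra hω
    simp only [Set.mem_iUnion, Set.mem_union, not_exists, not_or, Finset.mem_range, B,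
      Set.mem_ofPred_eq, not_le] at hω
    rw [hsum _ _ measurableSet_Iic] at hy
    set N : Set ℝ → ℝ := fun A => ∑ i ∈ S, A.indicator (fun _ => (1 : ℝ)) (Z i ω) with hN
    have hN0 : ∀ A, 0 ≤ N A := fun A =>
      Finset.sum_nonneg fun i _ => Set.indicator_nonneg (fun _ _ => zero_le_one) _
    have hNm : ∀ A, N A ≤ m := fun A => by
      calc N A ≤ ∑ i ∈ S, (1 : ℝ) :=
            Finset.sum_le_sum fun i _ => Set.indicator_le_self' (fun _ _ => zero_le_one) _
        _ = m := by simp [hm]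
    have hNmono : ∀ A A', A ⊆ A' → N A ≤ N A' := fun A A' h =>
      Finset.sum_le_sum fun i _ =>
        Set.indicator_le_indicator_of_subset h (fun _ => zero_le_one) _
    have hG0 : 0 ≤ ν.real (Set.Iic y) := measureReal_nonneg
    have hGm : ν.real (Set.Iic y) ≤ m := hνuniv ▸ measureReal_mono (Set.subset_univ _)
    have hcompl : ∀ u, N (Set.Ioi u) - ν.real (Set.Ioi u) =
        -(N (Set.Iic u) - ν.real (Set.Iic u)) := by
      intro u
      have h1 : N (Set.Iic u) + N (Set.Ioi u) = m := by
        rw [hN, ← Finset.sum_add_distrib]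
        have : ∀ i ∈ S, (Set.Iic u).indicator (fun _ => (1 : ℝ)) (Z i ω) +
            (Set.Ioi u).indicator (fun _ => (1 : ℝ)) (Z i ω) = 1 := by
          intro i _
          by_cases h : Z i ω ≤ u
          · simp [h]
          · simp [h, not_le.1 h]
        rw [Finset.sum_congr rfl this]; simp [hm]
      have h2 : ν.real (Set.Iic u) + ν.real (Set.Ioi u) = m := by
        rw [← hνuniv, ← Set.compl_Iic]
        exact measureReal_add_measureReal_compl measurableSet_Iic
      linarith
    rcases lt_abs.1 hy with hy | hy
    -- Too many points: `y < t (j + 1)`, so `N (Iic y) ≤ N (Iio (t (j + 1))) < j + 1 + s`. The open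
    -- half-line keeps the mass below `j + 1` despite atoms.
    · set j := ⌊ν.real (Set.Iic y)⌋₊ with hj
      have hj1 : ν.real (Set.Iic y) < j + 1 := Nat.lt_floor_add_one _
      have hj2 : (j : ℝ) ≤ ν.real (Set.Iic y) := Nat.floor_le hG0
      have hlt : j + 1 < m := by
        by_contra! hge
        have : (m : ℝ) ≤ j + 1 := by exact_mod_cast hge
        have := hNm (Set.Iic y)
        linarith
      obtain ⟨ht1, ht2⟩ := ht (j + 1) (by omega) hlt
      push_cast at ht1 ht2
      have hyt : y < t (j + 1) := by
        by_contra! hle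
        have : ν.real (Set.Iic (t (j + 1))) ≤ ν.real (Set.Iic y) :=
          measureReal_mono (Set.Iic_subset_Iic.2 hle)
        linarith
      have h1 := (hω (j + 1) hlt).1
      rw [hsum _ _ measurableSet_Iio] at h1
      have h2 := hNmono (Set.Iic y) (Set.Iio (t (j + 1))) (Set.Iic_subset_Iio.2 hyt)
      linarith
    -- Too few points: `t j ≤ y` for the integer `j` just below `ν (Iic y)`, and an excess in `Ioi
    -- (t j)` is a deficit in `Iic (t j)`.
    · have hpos : 0 < ⌈ν.real (Set.Iic y)⌉₊ := by
        rw [Nat.ceil_pos]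
        have := hN0 (Set.Iic y)
        linarith
      obtain ⟨j, hj⟩ : ∃ j, ⌈ν.real (Set.Iic y)⌉₊ = j + 1 := ⟨_, (Nat.succ_pred hpos.ne').symm⟩
      have hj1 : ν.real (Set.Iic y) ≤ j + 1 := by exact_mod_cast hj ▸ Nat.le_ceil _
      have hj2 : (j : ℝ) < ν.real (Set.Iic y) := Nat.lt_ceil.1 (by omega)
      have hlt : j < m := by exact_mod_cast hj2.trans_le hGm
      have hj0 : 0 < j := by
        by_contra! h0
        have h00 : j = 0 := by omega
        have := hN0 (Set.Iic y)
        simp only [h00, Nat.cast_zero] at hj1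
        linarith
      obtain ⟨ht1, ht2⟩ := ht j hj0 hlt
      have hyt : t j ≤ y := by
        by_contra! hle
        have : ν.real (Set.Iic y) ≤ ν.real (Set.Iio (t j)) :=
          measureReal_mono (Set.Iic_subset_Iio.2 hle)
        linarith
      have h1 := (hω j hlt).2
      rw [hsum _ _ measurableSet_Ioi] at h1
      have h2 := hNmono (Set.Iic (t j)) (Set.Iic y) (Set.Iic_subset_Iic.2 hyt)
      have h3 := hcompl (t j)
      simp only [hN] at h3 h2 hy
      linarith
  calc _ ≤ P.real (⋃ j ∈ Finset.range m, (B (Set.Iio (t j)) ∪ B (Set.Ioi (t j)))) :=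
        measureReal_mono hsub (measure_ne_top _ _)
    _ ≤ ∑ j ∈ Finset.range m, P.real (B (Set.Iio (t j)) ∪ B (Set.Ioi (t j))) :=
        measureReal_biUnion_finset_le _ _
    _ ≤ ∑ _j ∈ Finset.range m, 2 * Real.exp (-2 * s ^ 2 / m) := by
        refine Finset.sum_le_sum fun j _ => (measureReal_union_le _ _).trans ?_
        linarith [hB _ (measurableSet_Iio (a := t j)), hB _ (measurableSet_Ioi (a := t j))]
    _ = 2 * m * Real.exp (-2 * s ^ 2 / m) := by simp; ring

end UniformHoeffding

/-! ### Conditioning on the covariates -/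

section Conditioning

variable {E : Type*} [MeasurableSpace E] {ι : Type*}

/-- The sum over `S` of the differences between the indicators of `Y i ≤ y` and their conditional
probabilities given `X i`, at the data `z i = (X i, Y i)`. -/
noncomputable def centeredCount (κ : Kernel E ℝ) (S : Finset ι) (z : ι → E × ℝ) (y : ℝ) : ℝ :=
  ∑ i ∈ S, ((Set.Iic y).indicator (fun _ => (1 : ℝ)) (z i).2 - (κ (z i).1).real (Set.Iic y))

/-- Right continuity reduces the quantifier over `y` to rational values, which gives measurability.
-/
lemma continuousWithinAt_centeredCount (κ : Kernel E ℝ) [IsMarkovKernel κ] (S : Finset ι)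
    (z : ι → E × ℝ) (y : ℝ) : ContinuousWithinAt (centeredCount κ S z) (Set.Ici y) y := by
  refine tendsto_finsetSum _ fun i _ => Tendsto.sub ?_ ?_
  · refine tendsto_const_nhds.congr' ?_
    by_cases h : (z i).2 ≤ y
    · filter_upwards [self_mem_nhdsWithin] with y' hy'
      have : (z i).2 ≤ y' := h.trans hy'
      simp [h, this]
    · filter_upwards [nhdsWithin_le_nhds (eventually_lt_nhds (not_le.1 h))] with y' hy'
      simp [h, not_le.2 hy']
  · have h := (cdf (κ (z i).1)).right_continuous y
    have he : ⇑(cdf (κ (z i).1)) = fun y => (κ (z i).1).real (Set.Iic y) :=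
      funext fun y => cdf_eq_real _ y
    rwa [he] at h

lemma measurable_centeredCount (κ : Kernel E ℝ) [IsMarkovKernel κ] (S : Finset ι) (y : ℝ) :
    Measurable fun z : ι → E × ℝ => centeredCount κ S z y := by
  refine Finset.measurable_fun_sum _ fun i _ => Measurable.sub ?_ ?_
  · exact (measurable_const.indicator measurableSet_Iic).comp (measurable_pi_apply i).snd
  · exact ((κ.measurable_coe measurableSet_Iic).comp (measurable_pi_apply i).fst).ennreal_toReal

lemma measurableSet_exists_lt_abs_centeredCount (κ : Kernel E ℝ) [IsMarkovKernel κ]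
    (S : Finset ι) (s : ℝ) :
    MeasurableSet {z : ι → E × ℝ | ∃ y, s < |centeredCount κ S z y|} := by
  have h : {z : ι → E × ℝ | ∃ y, s < |centeredCount κ S z y|} =
      ⋃ q : ℚ, {z | s < |centeredCount κ S z q|} := by
    ext z
    simp only [Set.mem_ofPred_eq, Set.mem_iUnion]
    refine ⟨fun ⟨y, hy⟩ => ?_, fun ⟨q, hq⟩ => ⟨q, hq⟩⟩
    have h1 : ∀ᶠ y' in 𝓝[>] y, s < |centeredCount κ S z y'| :=
      nhdsWithin_mono _ Set.Ioi_subset_Ici_self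
        ((continuousWithinAt_centeredCount κ S z y).abs.eventually (eventually_gt_nhds hy))
    obtain ⟨w, hw, hyw⟩ := (mem_nhdsGT_iff_exists_Ioo_subset).1 h1
    obtain ⟨q, hq1, hq2⟩ := exists_rat_btwn (Set.mem_Ioi.1 hw)
    exact ⟨q, hyw ⟨hq1, hq2⟩⟩
  rw [h]
  exact MeasurableSet.iUnion fun q =>
    measurableSet_lt measurable_const (measurable_centeredCount κ S q).abs

/-- A kernel with values in `ℝ` is a measurable function of its argument and of an independent
uniform random variable. -/
lemma exists_map_prod_eq_compProd (κ : Kernel E ℝ) [IsMarkovKernel κ] :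
    ∃ f : E → unitInterval → ℝ, Measurable (Function.uncurry f) ∧
      (∀ x, volume.map (f x) = κ x) ∧
      ∀ (PX : Measure E) [IsProbabilityMeasure PX],
        (PX.prod volume).map (fun p => (p.1, f p.1 p.2)) = PX ⊗ₘ κ := by
  obtain ⟨f, hf, hfκ⟩ := κ.exists_measurable_map_eq_unitInterval
  refine ⟨f, hf, hfκ, fun PX _ => ?_⟩
  have hm : Measurable fun p : E × unitInterval => (p.1, f p.1 p.2) := measurable_fst.prodMk hf
  ext A hA
  rw [Measure.map_apply hm hA, Measure.prod_apply (hm hA), Measure.compProd_apply hA]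
  refine lintegral_congr fun x => ?_
  have hfx : Measurable (f x) := hf.comp measurable_prodMk_left
  rw [← hfκ x, Measure.map_apply hfx (measurable_prodMk_left hA)]
  rfl

variable [Fintype ι]

/-- The sample is a function of the covariates and independent uniform variables, so conditioning on
the covariates becomes Fubini's theorem. -/
lemma map_prod_pi_eq_pi_compProd {κ : Kernel E ℝ} [IsMarkovKernel κ] {f : E → unitInterval → ℝ}
    (hf : Measurable (Function.uncurry f)) {PX : Measure E} [IsProbabilityMeasure PX]
    (hfκ : (PX.prod volume).map (fun p => (p.1, f p.1 p.2)) = PX ⊗ₘ κ) :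
    ((Measure.pi fun _ : ι => PX).prod
        (Measure.pi fun _ : ι => (volume : Measure unitInterval))).map
      (fun p i => (p.1 i, f (p.1 i) (p.2 i))) = Measure.pi fun _ : ι => PX ⊗ₘ κ := by
  have hm : Measurable fun p : E × unitInterval => (p.1, f p.1 p.2) := measurable_fst.prodMk hf
  have hmp := measurePreserving_arrowProdEquivProdArrow E unitInterval ι (fun _ => PX)
    (fun _ => volume)
  rw [← hmp.map_eq, Measure.map_map]
  · have : (fun _ : ι => PX ⊗ₘ κ) =
        fun _ : ι => (PX.prod volume).map (fun p => (p.1, f p.1 p.2)) := by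
      rw [hfκ]
    have hσ : ∀ _i : ι, SigmaFinite ((PX.prod (volume : Measure unitInterval)).map
        (fun p => (p.1, f p.1 p.2))) := fun _ => by rw [hfκ]; infer_instance
    rw [this, ← Measure.pi_map_pi (hμ := hσ) fun _ => hm.aemeasurable]
    rfl
  · refine measurable_pi_lambda _ fun i => ?_
    have h1 : Measurable fun p : (ι → E) × (ι → unitInterval) => (p.1 i, p.2 i) :=
      ((measurable_pi_apply i).comp measurable_fst).prodMk
        ((measurable_pi_apply i).comp measurable_snd)
    exact h1.fst.prodMk (hf.comp h1)
  · exact hmp.measurable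

end Conditioning

/-! ### Union bound over ball traces -/

section Balls

variable {E : Type*} [NormedAddCommGroup E] [InnerProductSpace ℝ E] [FiniteDimensional ℝ E]
  [MeasurableSpace E] [BorelSpace E] {ι : Type*} [Fintype ι]

lemma measurableSet_mem_ballTraces (S : Finset ι) :
    MeasurableSet {x : ι → E | S ∈ ballTraces x} := by
  have : ProperSpace E := FiniteDimensional.proper ℝ E
  have : SecondCountableTopology E := inferInstance
  have h : {x : ι → E | S ∈ ballTraces x} = ⋃ (k : ℕ) (q : ℚ), ⋂ i,
      {x | i ∈ S ↔ x i ∈ Metric.closedBall (TopologicalSpace.denseSeq E k) (q : ℝ)} := by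
    ext x
    simp only [Set.mem_iUnion, Set.mem_iInter, Set.mem_ofPred_eq, mem_ballTraces]
    refine ⟨fun ⟨c, r, hcr⟩ => ?_, fun ⟨k, q, h⟩ => ⟨_, _, h⟩⟩
    -- Moving the centre by less than `ε` and taking a rational radius between `r + ε` and `r + 2 ε`
    -- keeps the trace if excluded points lie farther than `r + 3 ε`.
    have hev : ∀ᶠ ε : ℝ in 𝓝[>] 0, ∀ i, i ∉ S → r + 3 * ε < dist (x i) c := by
      refine eventually_all.2 fun i => ?_
      by_cases hi : i ∈ S
      · exact Eventually.of_forall fun _ h => absurd hi h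
      · have hlt : r + 3 * 0 < dist (x i) c := by
          rw [hcr, Metric.mem_closedBall, not_le] at hi; simpa using hi
        have hc : Tendsto (fun ε : ℝ => r + 3 * ε) (𝓝[>] 0) (𝓝 (r + 3 * 0)) :=
          (Continuous.tendsto (by fun_prop) 0).mono_left nhdsWithin_le_nhds
        filter_upwards [hc.eventually (eventually_lt_nhds hlt)] with ε hε _ using hε
    obtain ⟨ε, hε, hε0⟩ := (hev.and self_mem_nhdsWithin).exists
    replace hε0 : 0 < ε := hε0
    obtain ⟨k, hk⟩ := (TopologicalSpace.denseRange_denseSeq E).exists_dist_lt c hε0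
    obtain ⟨q, hq1, hq2⟩ := exists_rat_btwn (show r + ε < r + 2 * ε by linarith)
    refine ⟨k, q, fun i => ?_⟩
    rw [Metric.mem_closedBall]
    constructor
    · intro hi
      have h1 := Metric.mem_closedBall.1 ((hcr i).1 hi)
      linarith [dist_triangle (x i) c (TopologicalSpace.denseSeq E k)]
    · intro hi
      by_contra hni
      have h1 := hε i hni
      have := dist_triangle (x i) (TopologicalSpace.denseSeq E k) c
      rw [dist_comm (TopologicalSpace.denseSeq E k) c] at this
      linarith
  rw [h]
  refine MeasurableSet.iUnion fun k => MeasurableSet.iUnion fun q => MeasurableSet.iInter fun i => ?_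
  have hm : MeasurableSet {x : ι → E |
      x i ∈ Metric.closedBall (TopologicalSpace.denseSeq E k) (q : ℝ)} :=
    measurable_pi_apply i Metric.isClosed_closedBall.measurableSet
  by_cases hi : i ∈ S
  · simpa only [hi, true_iff] using hm
  · simp only [hi, false_iff]
    exact hm.compl

/-- Uniformly over all closed balls and all half-lines, the conditionally centered counts are small
with high probability. -/
lemma measure_exists_ballTraces_deviation_le [Nonempty ι] (PX : Measure E) [IsProbabilityMeasure PX]
    (κ : Kernel E ℝ) [IsMarkovKernel κ] {a : ℝ} (ha : 0 ≤ a) :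
    (Measure.pi fun _ : ι => PX ⊗ₘ κ) {z | ∃ S ∈ ballTraces (fun i => (z i).1), ∃ y,
        a * √S.card + 1 < |centeredCount κ S z y|} ≤
      ENNReal.ofReal ((Module.finrank ℝ E + 3) * (Fintype.card ι : ℝ) ^ (Module.finrank ℝ E + 2) *
        (2 * Fintype.card ι * Real.exp (-2 * a ^ 2))) := by
  obtain ⟨f, hf, hfκ, hcomp⟩ := exists_map_prod_eq_compProd κ
  set B : Set (ι → E × ℝ) := {z | ∃ S ∈ ballTraces (fun i => (z i).1), ∃ y,
        a * √S.card + 1 < |centeredCount κ S z y|} with hBdef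
  have hB : MeasurableSet B := by
    have : B = ⋃ S : Finset ι, {z | S ∈ ballTraces (fun i => (z i).1)} ∩
        {z | ∃ y, a * √S.card + 1 < |centeredCount κ S z y|} := by
      ext z; simp [hBdef]
    rw [this]
    refine MeasurableSet.iUnion fun S => MeasurableSet.inter ?_
      (measurableSet_exists_lt_abs_centeredCount κ S _)
    exact (measurableSet_mem_ballTraces (E := E) S).preimage
      (measurable_pi_lambda _ fun i => (measurable_pi_apply i).fst)
  have hΦ : Measurable fun (p : (ι → E) × (ι → unitInterval)) i =>
      (p.1 i, f (p.1 i) (p.2 i)) := by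
    refine measurable_pi_lambda _ fun i => ?_
    have h1 : Measurable fun p : (ι → E) × (ι → unitInterval) => (p.1 i, p.2 i) :=
      ((measurable_pi_apply i).comp measurable_fst).prodMk
        ((measurable_pi_apply i).comp measurable_snd)
    exact h1.fst.prodMk (hf.comp h1)
  rw [← map_prod_pi_eq_pi_compProd hf (hcomp PX), Measure.map_apply hΦ hB,
    Measure.prod_apply (hΦ hB)]
  set P : Measure (ι → unitInterval) := Measure.pi fun _ => volume with hP
  -- With `x` fixed the family of traces is deterministic, so a union bound applies.
  have hsec : ∀ x : ι → E, P (Prod.mk x ⁻¹' ((fun (p : (ι → E) × (ι → unitInterval)) i =>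
      (p.1 i, f (p.1 i) (p.2 i))) ⁻¹' B)) ≤
      ENNReal.ofReal ((Module.finrank ℝ E + 3) * (Fintype.card ι : ℝ) ^ (Module.finrank ℝ E + 2) *
        (2 * Fintype.card ι * Real.exp (-2 * a ^ 2))) := by
    intro x
    rw [← ofReal_measureReal]
    refine ENNReal.ofReal_le_ofReal ?_
    set Z : ι → (ι → unitInterval) → ℝ := fun i u => f (x i) (u i) with hZdef
    have hfx : ∀ e, Measurable (f e) := fun e => hf.comp measurable_prodMk_left
    have hZ : ∀ i, Measurable (Z i) := fun i => (hfx (x i)).comp (measurable_pi_apply i)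
    have hind : iIndepFun Z P := iIndepFun_pi fun i => (hfx (x i)).aemeasurable
    have hκ : ∀ i y, P.real (Z i ⁻¹' Set.Iic y) = (κ (x i)).real (Set.Iic y) := by
      intro i y
      rw [← hfκ, Measure.real, Measure.real, Measure.map_apply (hfx _) measurableSet_Iic,
        ← (measurePreserving_eval (fun _ : ι => (volume : Measure unitInterval)) i).map_eq,
        Measure.map_apply (measurable_pi_apply i) (hfx _ measurableSet_Iic)]
      rfl
    have hsub : (Prod.mk x ⁻¹' ((fun (p : (ι → E) × (ι → unitInterval)) i =>
        (p.1 i, f (p.1 i) (p.2 i))) ⁻¹' B)) ⊆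
        ⋃ S ∈ ballTraces x, {u | ∃ y, a * √S.card + 1 < |∑ i ∈ S,
          ((Set.Iic y).indicator (fun _ => (1 : ℝ)) (Z i u) - P.real (Z i ⁻¹' Set.Iic y))|} := by
      rintro u ⟨S, hS, y, hy⟩
      simp only [Set.mem_iUnion]
      refine ⟨S, hS, y, ?_⟩
      simpa only [hκ, centeredCount] using hy
    calc _ ≤ _ := measureReal_mono hsub (measure_ne_top _ _)
      _ ≤ _ := measureReal_biUnion_finset_le _ _
      _ ≤ ∑ S ∈ ballTraces x, 2 * Fintype.card ι * Real.exp (-2 * a ^ 2) := by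
        refine Finset.sum_le_sum fun S _ => ?_
        refine (measure_exists_count_deviation_le hZ hind S (by positivity)).trans ?_
        rcases S.card.eq_zero_or_pos with h0 | h0
        · simp only [h0, Nat.cast_zero, mul_zero, zero_mul]; positivity
        · have h1 : (0 : ℝ) < S.card := by exact_mod_cast h0
          -- The scaling by `√|S|` makes the exponent independent of `S`.
          have h2 : -2 * (a * √S.card) ^ 2 / S.card = -2 * a ^ 2 := by
            rw [mul_pow, Real.sq_sqrt h1.le]; field_simp
          rw [h2]
          have : (S.card : ℝ) ≤ Fintype.card ι := by exact_mod_cast S.card_le_univ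
          gcongr
      _ = (ballTraces x).card * (2 * Fintype.card ι * Real.exp (-2 * a ^ 2)) := by simp
      _ ≤ _ := by
        gcongr
        exact_mod_cast card_ballTraces_le x
  calc _ ≤ ∫⁻ _x, _ ∂(Measure.pi fun _ : ι => PX) := lintegral_mono hsec
    _ = _ := by simp

end Balls

/-! ### Chernoff bound -/

section LowerTail

variable {Ω : Type*} [MeasurableSpace Ω] {μ : Measure Ω} [IsProbabilityMeasure μ]
  {E : Type*} [MeasurableSpace E] {ι : Type*} {X : ι → Ω → E}

/-- The lower tail Chernoff bound for the number of independent points in a set. -/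
lemma measure_count_le_half_le (hX : ∀ i, Measurable (X i)) (hind : iIndepFun X μ) (s : Finset ι)
    {A : Set E} (hA : MeasurableSet A) {p : ℝ} (hp0 : 0 ≤ p)
    (hp : ∀ i, p ≤ μ.real (X i ⁻¹' A)) :
    μ.real {ω | ∑ i ∈ s, A.indicator (fun _ => (1 : ℝ)) (X i ω) ≤ s.card * p / 2} ≤
      Real.exp (-(s.card * p / 10)) := by
  have hm : Measurable (A.indicator (fun _ => (1 : ℝ))) := measurable_const.indicator hA
  set W : ι → Ω → ℝ := fun i ω => A.indicator (fun _ => (1 : ℝ)) (X i ω) with hW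
  have hWm : ∀ i, Measurable (W i) := fun i => hm.comp (hX i)
  have hWind : iIndepFun W μ := hind.comp (fun _ => A.indicator (fun _ => (1 : ℝ))) fun _ => hm
  have hW01 : ∀ i ω, 0 ≤ W i ω := fun i ω => Set.indicator_nonneg (fun _ _ => zero_le_one) _
  have hmgf : ∀ i, mgf (W i) μ (-1) ≤ Real.exp (-(p * (1 - Real.exp (-1)))) := by
    intro i
    have he : ∀ ω, Real.exp (-1 * W i ω) =
        1 - (1 - Real.exp (-1)) * (X i ⁻¹' A).indicator 1 ω := by
      intro ω
      by_cases h : X i ω ∈ A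
      · simp [hW, h]
      · simp [hW, h]
    have hint : Integrable ((X i ⁻¹' A).indicator (1 : Ω → ℝ)) μ :=
      (integrable_const (1 : ℝ)).indicator (hX i hA)
    have h1 : mgf (W i) μ (-1) = 1 - (1 - Real.exp (-1)) * μ.real (X i ⁻¹' A) := by
      simp only [mgf, he]
      rw [integral_sub (integrable_const _) (hint.const_mul _), integral_const_mul,
        integral_indicator_one (hX i hA)]
      simp
    have h2 : Real.exp (-1) ≤ 1 := Real.exp_le_one_iff.2 (by norm_num)
    have h3 := Real.add_one_le_exp (-(p * (1 - Real.exp (-1))))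
    rw [h1]
    nlinarith [hp i]
  have hexp : Integrable (fun ω => Real.exp (-1 * ∑ i ∈ s, W i ω)) μ := by
    refine Integrable.of_bound (C := 1) ?_ (ae_of_all _ fun ω => ?_)
    · exact (Real.measurable_exp.comp
        ((Finset.measurable_fun_sum s fun i _ => hWm i).const_mul _)).aestronglyMeasurable
    · rw [Real.norm_eq_abs, Real.abs_exp, Real.exp_le_one_iff]
      linarith [Finset.sum_nonneg fun i (_ : i ∈ s) => hW01 i ω]
  have h := measure_le_le_exp_mul_mgf (X := fun ω => ∑ i ∈ s, W i ω) (μ := μ) (t := -1)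
    (s.card * p / 2) (by norm_num) hexp
  refine h.trans ?_
  have hs : (fun ω => ∑ i ∈ s, W i ω) = ∑ i ∈ s, W i := by ext; simp
  rw [hs, hWind.mgf_sum hWm s]
  have hprod : ∏ i ∈ s, mgf (W i) μ (-1) ≤ Real.exp (-(p * (1 - Real.exp (-1)))) ^ s.card :=
    (Finset.prod_le_prod (fun i _ => mgf_nonneg) fun i _ => hmgf i).trans_eq (by simp)
  refine (mul_le_mul_of_nonneg_left hprod (Real.exp_nonneg _)).trans ?_
  rw [← Real.exp_nat_mul, ← Real.exp_add, Real.exp_le_exp]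
  -- The exponent is `-|s| p (1 / 2 - exp (-1))`, and `1 / 2 - 2 / 5 = 1 / 10`.
  have h4 : Real.exp (-1) ≤ 2 / 5 := by linarith [Real.exp_neg_one_lt_d9]
  have h5 : 0 ≤ s.card * p := by positivity
  nlinarith

end LowerTail

/-! ### Grid cells of the cube -/

section Cells

variable {d : ℕ}

/-- The cell with index `j` of the subdivision of the unit cube into `m ^ d` cubes. -/
def gridCell (m : ℕ) (j : Fin d → Fin m) : Set (EuclideanSpace ℝ (Fin d)) :=
  {x | ∀ i, x i ∈ Set.Icc ((j i : ℝ) / m) (((j i : ℝ) + 1) / m)}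

lemma gridCell_subset_unitCube {m : ℕ} (j : Fin d → Fin m) : gridCell m j ⊆ unitCube d := by
  intro x hx i
  have hm : (0 : ℝ) < m := by exact_mod_cast (j i).pos
  have hj : ((j i : ℕ) : ℝ) + 1 ≤ m := by exact_mod_cast (j i).isLt
  refine ⟨le_trans (by positivity) (hx i).1, (hx i).2.trans ?_⟩
  rwa [div_le_one hm]

lemma measurableSet_unitCube : MeasurableSet (unitCube d) := by
  have : unitCube d = ⋂ i, {x | x i ∈ Set.Icc (0 : ℝ) 1} := by
    ext; simp [unitCube]
  rw [this]
  exact MeasurableSet.iInter fun i =>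
    (show Measurable fun x : EuclideanSpace ℝ (Fin d) => x i by fun_prop) measurableSet_Icc

lemma measurableSet_gridCell {m : ℕ} (j : Fin d → Fin m) : MeasurableSet (gridCell m j) := by
  have : gridCell m j = ⋂ i, {x | x i ∈ Set.Icc ((j i : ℝ) / m) (((j i : ℝ) + 1) / m)} := by
    ext; simp [gridCell]
  rw [this]
  exact MeasurableSet.iInter fun i =>
    (show Measurable fun x : EuclideanSpace ℝ (Fin d) => x i by fun_prop) measurableSet_Icc

lemma volume_gridCell {m : ℕ} (j : Fin d → Fin m) :
    volume (gridCell m j) = ENNReal.ofReal (1 / m) ^ d := by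
  have h := (PiLp.volume_preserving_ofLp (Fin d)).measure_preimage
    (s := Set.Icc (fun i => (j i : ℝ) / m) (fun i => ((j i : ℝ) + 1) / m))
    measurableSet_Icc.nullMeasurableSet
  have he : WithLp.ofLp ⁻¹' Set.Icc (fun i => (j i : ℝ) / m) (fun i => ((j i : ℝ) + 1) / m) =
      gridCell m j := by
    ext x
    simp [gridCell, Pi.le_def, forall_and]
  rw [← he]
  refine h.trans ?_
  rw [Real.volume_Icc_pi]
  simp [add_div]

lemma exists_mem_gridCell {m : ℕ} (hm : 0 < m) {x : EuclideanSpace ℝ (Fin d)}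
    (hx : x ∈ unitCube d) : ∃ j : Fin d → Fin m, x ∈ gridCell m j := by
  have hm' : (0 : ℝ) < m := by exact_mod_cast hm
  have h : ∀ i, ∃ l : Fin m, x i ∈ Set.Icc ((l : ℝ) / m) (((l : ℝ) + 1) / m) := by
    intro i
    obtain ⟨h0, h1⟩ := hx i
    rcases h1.lt_or_eq with h1 | h1
    · have hl : ⌊m * x i⌋₊ < m := by
        rw [Nat.floor_lt (by positivity)]; nlinarith
      refine ⟨⟨_, hl⟩, ?_, ?_⟩
      · rw [div_le_iff₀ hm', mul_comm (x i)]; exact Nat.floor_le (by positivity)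
      · rw [le_div_iff₀ hm', mul_comm (x i)]; exact (Nat.lt_floor_add_one _).le
    -- On the face `x i = 1` the floor would give the invalid index `m`; the last closed cell is
    -- used instead.
    · refine ⟨⟨m - 1, by omega⟩, ?_⟩
      simp only [Nat.cast_sub (Nat.succ_le_of_lt hm), h1]
      refine ⟨by rw [div_le_one hm']; simp, ?_⟩
      rw [le_div_iff₀ hm']; simp
  choose j hj using h
  exact ⟨j, hj⟩

lemma gridCell_subset_closedBall {m : ℕ} {j : Fin d → Fin m} {x : EuclideanSpace ℝ (Fin d)}
    (hx : x ∈ gridCell m j) : gridCell m j ⊆ Metric.closedBall x (√d / m) := by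
  intro z hz
  have hc : ∀ i, (z i - x i) ^ 2 ≤ (1 / (m : ℝ)) ^ 2 := by
    intro i
    have h1 := hx i
    have h2 := hz i
    rw [Set.mem_Icc, add_div] at h1 h2
    refine sq_le_sq' ?_ ?_ <;> linarith [h1.1, h1.2, h2.1, h2.2]
  rw [mem_closedBall_iff_norm, EuclideanSpace.norm_eq]
  have : √d / m = √(∑ _i : Fin d, (1 / (m : ℝ)) ^ 2) := by
    simp [Real.sqrt_mul, Real.sqrt_sq, div_eq_mul_inv]
  rw [this]
  refine Real.sqrt_le_sqrt (Finset.sum_le_sum fun i _ => ?_)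
  simpa using hc i

lemma HasDensityBetween.measure_compl_unitCube {P : Measure (EuclideanSpace ℝ (Fin d))} {b U : ℝ}
    (h : HasDensityBetween P b U) : P (unitCube d)ᶜ = 0 := by
  obtain ⟨f, -, -, rfl⟩ := h
  rw [withDensity_apply _ measurableSet_unitCube.compl,
    Measure.restrict_restrict measurableSet_unitCube.compl]
  simp

lemma HasDensityBetween.le_measureReal_gridCell {P : Measure (EuclideanSpace ℝ (Fin d))}
    [IsProbabilityMeasure P] {b U : ℝ} (h : HasDensityBetween P b U) (hb : 0 ≤ b) {m : ℕ}
    (j : Fin d → Fin m) : b / m ^ d ≤ P.real (gridCell m j) := by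
  rw [Measure.real, ← ENNReal.ofReal_le_iff_le_toReal (measure_ne_top _ _)]
  obtain ⟨f, -, hf, rfl⟩ := h
  rw [withDensity_apply _ (measurableSet_gridCell j),
    Measure.restrict_restrict (measurableSet_gridCell j),
    Set.inter_eq_left.2 (gridCell_subset_unitCube j)]
  calc ENNReal.ofReal (b / m ^ d) = ∫⁻ _x in gridCell m j, ENNReal.ofReal b := by
        rw [lintegral_const, Measure.restrict_apply_univ, volume_gridCell,
          ← ENNReal.ofReal_pow (by positivity), ← ENNReal.ofReal_mul hb]
        simp [div_eq_mul_inv]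
    _ ≤ _ := setLIntegral_mono' (measurableSet_gridCell j) fun x hx =>
        ENNReal.ofReal_le_ofReal (hf x (gridCell_subset_unitCube j hx)).1

end Cells

/-! ### The nearest neighbour radius -/

section Radius

variable {d n k : ℕ} {X : ℕ → EuclideanSpace ℝ (Fin d)} {x : EuclideanSpace ℝ (Fin d)}

lemma bddBelow_knnRadius : BddBelow {τ : ℝ | 0 ≤ τ ∧
    (k : ℝ) ≤ ∑ i ∈ Finset.range n, (Metric.closedBall x τ).indicator (fun _ => (1 : ℝ)) (X i)} :=
  ⟨0, fun _ h => h.1⟩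

lemma knnRadius_le {τ : ℝ} (hτ : 0 ≤ τ) {A : Set (EuclideanSpace ℝ (Fin d))}
    (hA : A ⊆ Metric.closedBall x τ)
    (h : (k : ℝ) ≤ ∑ i ∈ Finset.range n, A.indicator (fun _ => (1 : ℝ)) (X i)) :
    knnRadius n k X x ≤ τ := by
  refine csInf_le bddBelow_knnRadius ⟨hτ, h.trans ?_⟩
  exact Finset.sum_le_sum fun i _ =>
    Set.indicator_le_indicator_of_subset hA (fun _ => zero_le_one) _

/-- The nearest neighbour ball contains at least `k` data points. -/
lemma le_count_knnBall (hk : k ≤ n) :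
    (k : ℝ) ≤ ∑ i ∈ Finset.range n, (knnBall n k X x).indicator (fun _ => (1 : ℝ)) (X i) := by
  set r := knnRadius n k X x with hr
  have hne : {τ : ℝ | 0 ≤ τ ∧ (k : ℝ) ≤ ∑ i ∈ Finset.range n,
      (Metric.closedBall x τ).indicator (fun _ => (1 : ℝ)) (X i)}.Nonempty := by
    refine ⟨∑ i ∈ Finset.range n, dist (X i) x, Finset.sum_nonneg fun _ _ => dist_nonneg, ?_⟩
    have : ∀ i ∈ Finset.range n, (Metric.closedBall x (∑ i ∈ Finset.range n, dist (X i) x)).indicator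
        (fun _ => (1 : ℝ)) (X i) = 1 := by
      intro i hi
      refine Set.indicator_of_mem ?_ _
      exact Finset.single_le_sum (f := fun i => dist (X i) x) (fun _ _ => dist_nonneg) hi
    rw [Finset.sum_congr rfl this]
    simpa using hk
  -- The infimum is attained: among finitely many points, a radius slightly above `r` captures no
  -- new one.
  have hev : ∀ᶠ τ in 𝓝[>] r, ∀ i ∈ Finset.range n, X i ∈ Metric.closedBall x τ →
      X i ∈ knnBall n k X x := by
    rw [Finset.eventually_all]
    intro i _
    by_cases hi : dist (X i) x ≤ r
    · exact Eventually.of_forall fun _ _ => hi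
    · filter_upwards [nhdsWithin_le_nhds (eventually_lt_nhds (not_le.1 hi))] with τ hτ h
      exact absurd h (not_le.2 hτ)
  obtain ⟨w, hw, hrw⟩ := (mem_nhdsGT_iff_exists_Ioo_subset).1 hev
  obtain ⟨τ, hmem, hτw⟩ := exists_lt_of_csInf_lt hne (show r < w from hw)
  have hrτ : r ≤ τ := csInf_le bddBelow_knnRadius hmem
  refine hmem.2.trans (Finset.sum_le_sum fun i hi => ?_)
  by_cases h : X i ∈ Metric.closedBall x τ
  · have : X i ∈ knnBall n k X x := by
      rcases hrτ.eq_or_lt with he | hlt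
      · rw [knnBall, ← hr, he]; exact h
      · exact hrw ⟨hlt, hτw⟩ i hi h
    simp only [Set.indicator_of_mem this, Set.indicator_of_mem h, le_refl]
  · rw [Set.indicator_of_notMem h]
    exact Set.indicator_nonneg (fun _ _ => zero_le_one) _

end Radius

/-! ### Splitting the error into noise and bias -/

section Deterministic

variable {d n k : ℕ} {X : ℕ → EuclideanSpace ℝ (Fin d)} {Y : ℕ → ℝ}
  {x : EuclideanSpace ℝ (Fin d)}

open scoped Classical in
lemma sum_range_mul_indicator_eq (f : ℕ → ℝ) (B : Set (EuclideanSpace ℝ (Fin d))) :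
    ∑ i ∈ Finset.range n, f i * B.indicator (fun _ => (1 : ℝ)) (X i) =
      ∑ i ∈ (Finset.univ.filter fun i : Fin n => X i ∈ B), f (i : ℕ) := by
  rw [Finset.sum_range, Finset.sum_filter]
  refine Finset.sum_congr rfl fun i _ => ?_
  by_cases h : X i ∈ B <;> simp [h]

/-- The error of the nearest neighbour estimate is bounded by a stochastic term and a bias term. -/
lemma abs_knnCondCdf_sub_cdf_le (hk : 1 ≤ k) (hkn : k ≤ n)
    {κ : Kernel (EuclideanSpace ℝ (Fin d)) ℝ} [IsMarkovKernel κ] {L ρ a : ℝ}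
    (hL : ∀ x ∈ unitCube d, ∀ x' ∈ unitCube d, ∀ y : ℝ,
      |cdf (κ x) y - cdf (κ x') y| ≤ L * ‖x - x'‖)
    (hX : ∀ i, X i ∈ unitCube d) (hx : x ∈ unitCube d) (hρ : knnRadius n k X x ≤ ρ)
    (ha : 0 ≤ a)
    (hdev : ∀ S ∈ ballTraces (fun i : Fin n => X i), ∀ y,
      |centeredCount κ S (fun i : Fin n => (X i, Y i)) y| ≤ a * √S.card + 1) (y : ℝ) :
    |knnCondCdf n k X Y y x - cdf (κ x) y| ≤ a / √k + 1 / k + |L| * ρ := by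
  classical
  set S : Finset (Fin n) := Finset.univ.filter fun i => X i ∈ knnBall n k X x with hS
  have hSmem : S ∈ ballTraces (fun i : Fin n => X i) :=
    mem_ballTraces.2 ⟨x, knnRadius n k X x, fun i => by simp [hS, knnBall]⟩
  have hden : ∑ i ∈ Finset.range n, (knnBall n k X x).indicator (fun _ => (1 : ℝ)) (X i) =
      S.card := by
    have h := sum_range_mul_indicator_eq (n := n) (X := X) (fun _ => 1) (knnBall n k X x)
    simpa [hS] using h
  have hkS : (k : ℝ) ≤ S.card := hden ▸ le_count_knnBall hkn
  have hk0 : (0 : ℝ) < k := by exact_mod_cast hk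
  have hS0 : (0 : ℝ) < S.card := hk0.trans_le hkS
  have hbias : |∑ i ∈ S, (cdf (κ (X i)) y - cdf (κ x) y)| ≤ S.card * (|L| * ρ) := by
    refine (Finset.abs_sum_le_sum_abs _ _).trans ?_
    rw [← nsmul_eq_mul]
    refine Finset.sum_le_card_nsmul _ _ _ fun i hi => (hL _ (hX i) _ hx y).trans ?_
    have h1 : ‖X i - x‖ ≤ ρ :=
      (mem_closedBall_iff_norm.1 (Finset.mem_filter.1 hi).2).trans hρ
    exact mul_le_mul (le_abs_self L) h1 (norm_nonneg _) (abs_nonneg L)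
  have hdecomp : knnCondCdf n k X Y y x - cdf (κ x) y =
      (centeredCount κ S (fun i : Fin n => (X i, Y i)) y +
        ∑ i ∈ S, (cdf (κ (X i)) y - cdf (κ x) y)) / S.card := by
    rw [knnCondCdf, hden, sum_range_mul_indicator_eq, ← hS, centeredCount,
      ← Finset.sum_add_distrib, eq_div_iff hS0.ne', sub_mul, div_mul_cancel₀ _ hS0.ne']
    simp only [cdf_eq_real, sub_add_sub_cancel]
    rw [Finset.sum_sub_distrib, Finset.sum_const, nsmul_eq_mul, mul_comm (S.card : ℝ)]
  rw [hdecomp, abs_div, abs_of_pos hS0]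
  calc _ ≤ (a * √S.card + 1 + S.card * (|L| * ρ)) / S.card := by
        gcongr
        exact (abs_add_le _ _).trans (add_le_add (hdev S hSmem y) hbias)
    _ = a / √S.card + 1 / S.card + |L| * ρ := by
        have h : a * √S.card / S.card = a / √S.card := by
          rw [mul_div_assoc, Real.sqrt_div_self', mul_one_div]
        rw [add_div, add_div, h, mul_div_cancel_left₀ _ hS0.ne']
    -- Ties may make `|S|` exceed `k`; only `k ≤ |S|` is needed.
    _ ≤ a / √k + 1 / k + |L| * ρ := by gcongr

end Deterministic

/-! ### Almost sure bounds by Borel–Cantelli -/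

section AlmostSure

variable {Ω : Type*} [MeasurableSpace Ω] {μ : Measure Ω}

lemma ae_eventually_notMem_of_le_div_sq {s : ℕ → Set Ω} {c : ℝ} (hc : 0 ≤ c)
    (h : ∀ᶠ n : ℕ in atTop, μ (s n) ≤ ENNReal.ofReal (c / (n : ℝ) ^ 2)) :
    ∀ᵐ ω ∂μ, ∀ᶠ n in atTop, ω ∉ s n := by
  obtain ⟨N, hN⟩ := eventually_atTop.1 h
  have hsum : Summable fun n : ℕ => c / ((n + N : ℕ) : ℝ) ^ 2 := by
    refine (summable_nat_add_iff (f := fun n : ℕ => c / (n : ℝ) ^ 2) N).2 ?_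
    simpa [div_eq_mul_inv] using (Real.summable_nat_pow_inv.2 one_lt_two).mul_left c
  have hne : ∑' n, μ (s (n + N)) ≠ ⊤ := by
    refine ne_top_of_le_ne_top ?_ (ENNReal.tsum_le_tsum fun n => hN (n + N) (by omega))
    rw [← ENNReal.ofReal_tsum_of_nonneg (fun n => by positivity) hsum]
    exact ENNReal.ofReal_ne_top
  filter_upwards [ae_eventually_notMem hne] with ω hω
  obtain ⟨M, hM⟩ := eventually_atTop.1 hω
  refine eventually_atTop.2 ⟨M + N, fun n hn => ?_⟩
  have := hM (n - N) (by omega)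
  rwa [Nat.sub_add_cancel (by omega)] at this

variable [IsProbabilityMeasure μ]

lemma ae_eventually_centeredCount_le {E : Type*} [NormedAddCommGroup E] [InnerProductSpace ℝ E]
    [FiniteDimensional ℝ E] [MeasurableSpace E] [BorelSpace E]
    {PX : Measure E} [IsProbabilityMeasure PX] {κ : Kernel E ℝ} [IsMarkovKernel κ]
    {X : ℕ → Ω → E} {Y : ℕ → Ω → ℝ} (hX : ∀ i, Measurable (X i)) (hY : ∀ i, Measurable (Y i))
    (hind : iIndepFun (fun i ω => (X i ω, Y i ω)) μ)
    (hlaw : ∀ i, μ.map (fun ω => (X i ω, Y i ω)) = PX ⊗ₘ κ) :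
    ∀ᵐ ω ∂μ, ∀ᶠ n : ℕ in atTop, ∀ S ∈ ballTraces (fun i : Fin n => X i ω), ∀ y,
      |centeredCount κ S (fun i : Fin n => (X i ω, Y i ω)) y| ≤
        √((Module.finrank ℝ E + 5) / 2 * Real.log n) * √S.card + 1 := by
  set D := Module.finrank ℝ E with hD
  set s : ℕ → Set Ω := fun n => {ω | ∃ S ∈ ballTraces (fun i : Fin n => X i ω), ∃ y,
    √((D + 5) / 2 * Real.log n) * √S.card + 1 <
      |centeredCount κ S (fun i : Fin n => (X i ω, Y i ω)) y|} with hs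
  have key : ∀ᵐ ω ∂μ, ∀ᶠ n in atTop, ω ∉ s n := by
    refine ae_eventually_notMem_of_le_div_sq (c := 2 * (D + 3)) (by positivity) ?_
    filter_upwards [eventually_ge_atTop 1] with n hn
    have hn0 : (0 : ℝ) < n := by exact_mod_cast hn
    have hn1 : (1 : ℝ) ≤ n := by exact_mod_cast hn
    have : Nonempty (Fin n) := ⟨⟨0, hn⟩⟩
    have hXY : ∀ i, Measurable fun ω => (X i ω, Y i ω) := fun i => (hX i).prodMk (hY i)
    have hmap : μ.map (fun ω (i : Fin n) => (X i ω, Y i ω)) =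
        Measure.pi fun _ : Fin n => PX ⊗ₘ κ := by
      have h := (iIndepFun_iff_map_fun_eq_pi_map
        (f := fun (i : Fin n) ω => (X i ω, Y i ω)) fun i => (hXY i).aemeasurable).1
        (hind.precomp (g := ((↑) : Fin n → ℕ)) Fin.val_injective)
      simpa only [hlaw] using h
    have hle := measure_exists_ballTraces_deviation_le (ι := Fin n) PX κ
      (Real.sqrt_nonneg ((D + 5) / 2 * Real.log n))
    rw [← hmap] at hle
    refine (Measure.le_map_apply
      (measurable_pi_lambda _ fun i : Fin n => hXY i).aemeasurable _).trans (hle.trans ?_)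
    refine ENNReal.ofReal_le_ofReal (le_of_eq ?_)
    rw [Real.sq_sqrt (mul_nonneg (by positivity) (Real.log_nonneg hn1)), Fintype.card_fin]
    -- The factor `n ^ (-(D + 5))` beats `n ^ (D + 2)` from the traces and `n` from the thresholds,
    -- leaving the summable `n ^ (-2)`.
    have hexp : Real.exp (-2 * ((D + 5) / 2 * Real.log n)) = ((n : ℝ) ^ (D + 5))⁻¹ := by
      rw [← Real.exp_log (pow_pos hn0 (D + 5)), ← Real.exp_neg, Real.log_pow]
      push_cast
      congr 1
      ring
    rw [hexp, ← hD]
    field_simp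
    ring
  filter_upwards [key] with ω hω
  filter_upwards [hω] with n hn S hS y
  by_contra! h
  exact hn ⟨S, hS, y, h⟩

/-- Almost surely, all cells of a sufficiently coarse grid contain at least `k n` points. -/
lemma ae_eventually_le_count_gridCell {d : ℕ} {PX : Measure (EuclideanSpace ℝ (Fin d))}
    [IsProbabilityMeasure PX] {b U : ℝ} (hb : 0 < b) (hPX : HasDensityBetween PX b U)
    {X : ℕ → Ω → EuclideanSpace ℝ (Fin d)} (hX : ∀ i, Measurable (X i)) (hind : iIndepFun X μ)
    (hlaw : ∀ i, μ.map (X i) = PX) {k m : ℕ → ℕ} (hk : ∀ n, 1 ≤ n → 1 ≤ k n)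
    (hlog : Tendsto (fun n : ℕ => Real.log (n : ℝ) / (k n : ℝ)) atTop (𝓝 0))
    (hm0 : ∀ᶠ n in atTop, 0 < m n)
    (hm : ∀ᶠ n in atTop, (m n : ℝ) ^ d ≤ n * b / (2 * k n)) :
    ∀ᵐ ω ∂μ, ∀ᶠ n : ℕ in atTop, ∀ j : Fin d → Fin (m n),
      (k n : ℝ) ≤ ∑ i ∈ Finset.range n,
        (gridCell (m n) j).indicator (fun _ => (1 : ℝ)) (X i ω) := by
  set s : ℕ → Set Ω := fun n => ⋃ j : Fin d → Fin (m n), {ω | ∑ i ∈ Finset.range n,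
        (gridCell (m n) j).indicator (fun _ => (1 : ℝ)) (X i ω) ≤
          (Finset.range n).card * (b / (m n : ℝ) ^ d) / 2} with hs
  have hhalf : ∀ᶠ n : ℕ in atTop, (k n : ℝ) ≤ n * (b / (m n : ℝ) ^ d) / 2 := by
    filter_upwards [hm, hm0, eventually_ge_atTop 1] with n hn hn0 hn1
    have h0 : (0 : ℝ) < (m n : ℝ) ^ d := pow_pos (by exact_mod_cast hn0) d
    have hk0 : (0 : ℝ) < k n := by exact_mod_cast hk n hn1
    rw [le_div_iff₀ (by positivity)] at hn
    have he : n * (b / (m n : ℝ) ^ d) / 2 = n * b / 2 / (m n : ℝ) ^ d := by ring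
    rw [he, le_div_iff₀ h0]
    linarith
  have key : ∀ᵐ ω ∂μ, ∀ᶠ n in atTop, ω ∉ s n := by
    refine ae_eventually_notMem_of_le_div_sq hb.le ?_
    -- With `p = b / m ^ d`, `n p / 10 ≥ k / 5 ≥ 3 log n` once `log n ≤ k / 15`. Each cell then
    -- fails with probability at most `n ^ (-3)`, and there are at most `n b` cells.
    filter_upwards [hm, hhalf, eventually_ge_atTop 1,
      hlog.eventually (eventually_le_nhds (show (0 : ℝ) < 1 / 15 by norm_num))]
      with n hmn hkn hn1 hlogn
    have hn0 : (0 : ℝ) < n := by exact_mod_cast hn1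
    have hk0 : (0 : ℝ) < k n := by exact_mod_cast hk n hn1
    have hk1 : (1 : ℝ) ≤ k n := by exact_mod_cast hk n hn1
    rw [← ofReal_measureReal]
    refine ENNReal.ofReal_le_ofReal ?_
    have hcell : ∀ j : Fin d → Fin (m n), μ.real {ω | ∑ i ∈ Finset.range n,
        (gridCell (m n) j).indicator (fun _ => (1 : ℝ)) (X i ω) ≤
          (Finset.range n).card * (b / (m n : ℝ) ^ d) / 2} ≤ ((n : ℝ) ^ 3)⁻¹ := by
      intro j
      refine (measure_count_le_half_le hX hind _ (measurableSet_gridCell j) (by positivity)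
        fun i => ?_).trans ?_
      · rw [← map_measureReal_apply (hX i) (measurableSet_gridCell j), hlaw]
        exact hPX.le_measureReal_gridCell hb.le j
      · rw [← Real.exp_log (pow_pos hn0 3), ← Real.exp_neg, Real.exp_le_exp, Real.log_pow,
          Finset.card_range]
        rw [div_le_iff₀ hk0] at hlogn
        push_cast
        linarith
    calc μ.real (s n) ≤ ∑ j : Fin d → Fin (m n), μ.real {ω | ∑ i ∈ Finset.range n,
        (gridCell (m n) j).indicator (fun _ => (1 : ℝ)) (X i ω) ≤
          (Finset.range n).card * (b / (m n : ℝ) ^ d) / 2} := measureReal_iUnion_fintype_le _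
      _ ≤ ∑ _j : Fin d → Fin (m n), ((n : ℝ) ^ 3)⁻¹ := Finset.sum_le_sum fun j _ => hcell j
      _ = (m n : ℝ) ^ d * ((n : ℝ) ^ 3)⁻¹ := by simp
      _ ≤ (n * b) * ((n : ℝ) ^ 3)⁻¹ := by
        gcongr
        exact hmn.trans (div_le_self (by positivity) (by linarith))
      _ = b / (n : ℝ) ^ 2 := by field_simp
  filter_upwards [key] with ω hω
  filter_upwards [hω, hhalf] with n hn hkn j
  by_contra! h
  refine hn (Set.mem_iUnion.2 ⟨j, ?_⟩)
  simp only [Set.mem_ofPred_eq, Finset.card_range]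
  exact h.le.trans hkn

end AlmostSure

/-! ### Choice of the grid and of the constants -/

theorem theorem3 (d : ℕ) (hd : 0 < d) (b U L : ℝ) (hb : 0 < b) :
    ∃ C : ℝ,
      ∀ (Ω : Type*) [MeasurableSpace Ω] (μ : Measure Ω) [IsProbabilityMeasure μ]
        -- the law of `X`, and the conditional law of `Y` given `X = x`
        (PX : Measure (EuclideanSpace ℝ (Fin d))) [IsProbabilityMeasure PX]
        (κ : Kernel (EuclideanSpace ℝ (Fin d)) ℝ) [IsMarkovKernel κ]
        -- the data and the number of neighbours
        (X : ℕ → Ω → EuclideanSpace ℝ (Fin d)) (Y : ℕ → Ω → ℝ) (k : ℕ → ℕ),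
        HasDensityBetween PX b U →
        (∀ x ∈ unitCube d, ∀ x' ∈ unitCube d, ∀ y : ℝ,
          |cdf (κ x) y - cdf (κ x') y| ≤ L * ‖x - x'‖) →
        (∀ i, Measurable (X i)) → (∀ i, Measurable (Y i)) →
        iIndepFun (fun i ω => (X i ω, Y i ω)) μ →
        (∀ i, μ.map (fun ω => (X i ω, Y i ω)) = PX ⊗ₘ κ) →
        (∀ n, 1 ≤ n → 1 ≤ k n ∧ k n ≤ n) →
        Tendsto (fun n : ℕ => (k n : ℝ) / (n : ℝ)) atTop (𝓝 0) →
        Tendsto (fun n : ℕ => Real.log (n : ℝ) / (k n : ℝ)) atTop (𝓝 0) →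
        ∀ᵐ ω ∂μ, ∀ᶠ n : ℕ in atTop, ∀ y : ℝ, ∀ x ∈ unitCube d,
          |knnCondCdf n (k n) (fun i => X i ω) (fun i => Y i ω) y x - cdf (κ x) y| ≤
            C * (Real.sqrt ((d : ℝ) / (k n : ℝ) * Real.log (n : ℝ)) +
              ((k n : ℝ) / (n : ℝ)) ^ ((1 : ℝ) / (d : ℝ))) := by
  set C₁ : ℝ := √(((d : ℝ) + 5) / 2) + 1 with hC₁
  set C₂ : ℝ := |L| * (2 * √d * (2 / b) ^ ((1 : ℝ) / d)) with hC₂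
  refine ⟨C₁ + C₂, ?_⟩
  intro Ω _ μ _ PX _ κ _ X Y k hPX hL hX hY hind hlaw hk hkn hlog
  have hd0 : (0 : ℝ) < d := by exact_mod_cast hd
  have hd1 : (1 : ℝ) ≤ d := by exact_mod_cast hd
  have hXlaw : ∀ i, μ.map (X i) = PX := by
    intro i
    have h := congrArg (Measure.map Prod.fst) (hlaw i)
    rw [Measure.map_map measurable_fst ((hX i).prodMk (hY i))] at h
    exact h.trans (Measure.fst_compProd PX κ)
  have hXind : iIndepFun X μ := hind.comp (fun _ => Prod.fst) fun _ => measurable_fst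
  -- Chosen so that a cell of side `1 / v` has probability at least `b / v ^ d = 2 k / n`.
  set v : ℕ → ℝ := fun n => (n * b / (2 * k n)) ^ ((1 : ℝ) / d) with hv
  set m : ℕ → ℕ := fun n => ⌊v n⌋₊ with hm
  have hv1 : ∀ᶠ n in atTop, 1 ≤ v n := by
    filter_upwards [hkn.eventually (eventually_le_nhds (show (0 : ℝ) < b / 2 by positivity)),
      eventually_ge_atTop 1] with n hn hn1
    have hn0 : (0 : ℝ) < n := by exact_mod_cast hn1
    have hk0 : (0 : ℝ) < k n := by exact_mod_cast (hk n hn1).1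
    refine Real.one_le_rpow ?_ (by positivity)
    rw [div_le_iff₀ hn0] at hn
    rw [le_div_iff₀ (by positivity)]
    linarith
  have hm0 : ∀ᶠ n in atTop, 0 < m n := by
    filter_upwards [hv1] with n hn using Nat.floor_pos.2 hn
  have hmd : ∀ᶠ n in atTop, (m n : ℝ) ^ d ≤ n * b / (2 * k n) := by
    refine Eventually.of_forall fun n => ?_
    have h0 : (0 : ℝ) ≤ n * b / (2 * k n) := by positivity
    calc (m n : ℝ) ^ d ≤ v n ^ d := by
          gcongr
          exact Nat.floor_le (by positivity)
      _ = n * b / (2 * k n) := by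
          rw [hv, one_div]
          exact Real.rpow_inv_natCast_pow h0 hd.ne'
  have hcube : ∀ᵐ ω ∂μ, ∀ i, X i ω ∈ unitCube d := by
    refine ae_all_iff.2 fun i => ?_
    have h : ∀ᵐ x ∂(μ.map (X i)), x ∈ unitCube d := by
      rw [hXlaw]; exact hPX.measure_compl_unitCube
    exact ae_of_ae_map (hX i).aemeasurable h
  filter_upwards [hcube, ae_eventually_centeredCount_le hX hY hind hlaw,
    ae_eventually_le_count_gridCell hb hPX hX hXind hXlaw (fun n hn => (hk n hn).1) hlog hm0 hmd]
    with ω hω hdev hgrid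
  filter_upwards [hdev, hgrid, hv1, hm0, eventually_ge_atTop 3] with n hdevn hgridn hvn hmn hn3
    y x hx
  rw [finrank_euclideanSpace_fin] at hdevn
  obtain ⟨hk1, hkle⟩ := hk n (by omega)
  have hk0 : (0 : ℝ) < k n := by exact_mod_cast hk1
  have hk1' : (1 : ℝ) ≤ k n := by exact_mod_cast hk1
  have hn0 : (0 : ℝ) < n := by positivity
  have hlogn : 1 ≤ Real.log n := by
    rw [Real.le_log_iff_exp_le hn0]
    have : (3 : ℝ) ≤ n := by exact_mod_cast hn3
    linarith [Real.exp_one_lt_d9]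
  have hrad : knnRadius n (k n) (fun i => X i ω) x ≤ √d / m n := by
    obtain ⟨j, hj⟩ := exists_mem_gridCell hmn hx
    exact knnRadius_le (by positivity) (gridCell_subset_closedBall hj) (hgridn j)
  refine (abs_knnCondCdf_sub_cdf_le hk1 hkle hL hω hx hrad (Real.sqrt_nonneg _) hdevn y).trans ?_
  set R₁ := √((d : ℝ) / k n * Real.log n) with hR₁
  set R₂ := ((k n : ℝ) / n) ^ ((1 : ℝ) / d) with hR₂
  have h1 : √(((d : ℝ) + 5) / 2 * Real.log n) / √(k n) ≤ √(((d : ℝ) + 5) / 2) * R₁ := by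
    rw [hR₁, ← Real.sqrt_div' _ hk0.le, ← Real.sqrt_mul (by positivity)]
    refine Real.sqrt_le_sqrt ?_
    rw [mul_div_assoc]
    gcongr
    rw [div_mul_eq_mul_div]
    gcongr
    nlinarith
  -- The rounding loss is absorbed since `k ≥ 1` and `d log n ≥ 1`.
  have h2 : 1 / (k n : ℝ) ≤ R₁ := by
    refine Real.le_sqrt_of_sq_le ?_
    rw [div_pow, one_pow, div_mul_eq_mul_div, div_le_div_iff₀ (by positivity) hk0]
    have : 1 ≤ d * Real.log n := one_le_mul_of_one_le_of_one_le hd1 hlogn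
    nlinarith
  have h3 : √d / m n ≤ 2 * √d * (2 / b) ^ ((1 : ℝ) / d) * R₂ := by
    -- Since `m ≥ 1`, rounding `v` down loses at most a factor 2.
    have hfl : v n / 2 ≤ m n := by
      have := Nat.lt_floor_add_one (v n)
      have h1m : (1 : ℝ) ≤ m n := by exact_mod_cast hmn
      have : v n < m n + 1 := this
      linarith
    have hvinv : (v n)⁻¹ = (2 / b) ^ ((1 : ℝ) / d) * R₂ := by
      rw [hv, hR₂, ← Real.inv_rpow (by positivity), ← Real.mul_rpow (by positivity) (by positivity)]
      congr 1
      field_simp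
    calc √d / m n ≤ √d / (v n / 2) := by gcongr
      _ = 2 * √d * (v n)⁻¹ := by field_simp
      _ = _ := by rw [hvinv]; ring
  have h4 : |L| * (√d / m n) ≤ C₂ * R₂ := by
    rw [hC₂, mul_assoc |L|]
    gcongr
  have hR₁0 : 0 ≤ R₁ := Real.sqrt_nonneg _
  have hR₂0 : 0 ≤ R₂ := by positivity
  have hC₁0 : 0 ≤ C₁ := by positivity
  have hC₂0 : 0 ≤ C₂ := by positivity
  have h5 : √(((d : ℝ) + 5) / 2) * R₁ + R₁ = C₁ * R₁ := by rw [hC₁]; ring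
  nlinarith [mul_nonneg hC₁0 hR₂0, mul_nonneg hC₂0 hR₁0]
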